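/- For $n\ge 0$ let $\mathbf I_n$ be the set of inversion sequences of length $n$, i.e. sequences $(e_1,\dots,e_n)$ of integers with $0\le e_i<i$; for $n,p\ge 1$ let $\mathbf I_{n,p}$ be the set of sequences $(e_1,\dots,e_n)$ with $0\le e_i<s_i$, where $(s_1,\dots,s_n)=(p,p+2,p+3,\dots,p+n)$. A sequence avoids a pattern $P$ if none of its subsequences is order isomorphic to $P$; $\mathbf I_n(P)$ and $\mathbf I_{n,p}(P)$ denote the $P$-avoiding members. Let $\mathsf{asc}(e)=|\{i: 1\le i<n,\ e_i<e_{i+1}\}|$, and for $e\in\mathbf I_n$ let $\mathsf{iar}(e)$ be the largest $p\le n$ with $e_i=i-1$ for all $1\le i\le p$. Let $R$ be a commutative ring and $t\in R$ (for instance $R=\mathbb Z[t]$ with $t$ an indeterminate), and put $$\mathcal I(x,t)=\sum_{n\ge1}x^n\sum_{e\in\mathbf I_n(0021)}t^{\mathsf{asc}(e)}\in R[[x]].$$ **Theorem.** There is a unique power series $r\in R[[x]]$ with zero constant term such that $$r^3-(2+x+t-xt^2)\,r^2+(1+2x)\,r-x=0 .$$ It begins $$r=x+tx^2+(t^2+2t)x^3+(t^3+8t^2+3t)x^4+(t^4+22t^3+27t^2+4t)x^5+\cdots,$$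 the series $1-r$ is invertible in $R[[x]]$, and $$\mathcal I(x,t)=\frac{r}{1-r}.$$ Moreover, for all $n,p\ge1$, deleting the first $p$ entries is a bijection from $\{e\in\mathbf I_{n+p}(0021):\mathsf{iar}(e)=p\}$ onto $\mathbf I_{n,p}(021)$. -/

import Mathlib

noncomputable section

namespace InvSeq

/-- `w` contains the pattern `P` if some subsequence of `w` is order isomorphic to `P`. -/
def Contains {n k : ℕ} (w : Fin n → ℕ) (P : Fin k → ℕ) : Prop :=
  ∃ f : Fin k ↪o Fin n, ∀ a b : Fin k, w (f a) < w (f b) ↔ P a < P b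

def Avoids {n k : ℕ} (w : Fin n → ℕ) (P : Fin k → ℕ) : Prop := ¬ Contains w P

/-- The `s`-inversion sequences: `0 ≤ e i < s i` for all `i`. -/
def sInvSeqs {n : ℕ} (s : Fin n → ℕ) : Finset (Fin n → ℕ) :=
  Fintype.piFinset fun i => Finset.range (s i)

/-- The inversion sequences of length `n`; positions are counted from `0`, so the bound on the
entry at `i : Fin n` is `i + 1`. -/
def invSeqs (n : ℕ) : Finset (Fin n → ℕ) := sInvSeqs fun i => (i : ℕ) + 1

/-- The `(p, p + 2, p + 3, …, p + n)`-inversion sequences (of length `n`). -/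
def invSeqsFrom (n p : ℕ) : Finset (Fin n → ℕ) :=
  sInvSeqs fun i => if (i : ℕ) = 0 then p else p + (i : ℕ) + 1

open Classical in
/-- The members of a finite set of sequences that avoid the pattern `P`. -/
def avoiding {n k : ℕ} (S : Finset (Fin n → ℕ)) (P : Fin k → ℕ) : Finset (Fin n → ℕ) :=
  S.filter fun e => Avoids e P

open Classical in
/-- The number of ascents. -/
def asc {n : ℕ} (w : Fin n → ℕ) : ℕ :=
  (Finset.univ.filter fun i : Fin n => ∃ h : (i : ℕ) + 1 < n, w i < w ⟨(i : ℕ) + 1, h⟩).card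

open Classical in
/-- The initial ascending run: the largest `p ≤ n` such that the first `p` entries are
`0, 1, …, p - 1`. See `iar_eq_iff` for the description by the next entry. -/
def iar {n : ℕ} (e : Fin n → ℕ) : ℕ :=
  Nat.findGreatest (fun p => ∀ i : Fin n, (i : ℕ) < p → e i = (i : ℕ)) n

theorem iar_eq_iff {n : ℕ} {e : Fin n → ℕ} (he : e ∈ invSeqs n) (p : ℕ) :
    iar e = p ↔ p ≤ n ∧ (∀ i : Fin n, (i : ℕ) < p → e i = (i : ℕ)) ∧
      ∀ h : p < n, e ⟨p, h⟩ < p := by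
  classical
  have hb : ∀ i, e i < (i : ℕ) + 1 := by
    simpa [invSeqs, sInvSeqs, Fintype.mem_piFinset] using he
  unfold iar
  rw [Nat.findGreatest_eq_iff]
  constructor
  · rintro ⟨h1, h2, h3⟩
    have h2' : ∀ i : Fin n, (i : ℕ) < p → e i = (i : ℕ) := by
      intro i hi
      exact h2 (by omega) i hi
    refine ⟨h1, h2', fun h => ?_⟩
    by_contra hc
    refine h3 (Nat.lt_succ_self p) h (fun i hi => ?_)
    rcases Nat.lt_succ_iff_lt_or_eq.mp hi with hlt | heq
    · exact h2' i hlt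
    · have hi' : i = ⟨p, h⟩ := Fin.ext heq
      have := hb ⟨p, h⟩
      subst hi'
      simp only at this ⊢
      omega
  · rintro ⟨h1, h2, h3⟩
    refine ⟨h1, fun _ => h2, fun m hm hmn hc => ?_⟩
    have := hc ⟨p, by omega⟩ hm
    have h4 := h3 (by omega)
    simp only at this
    omega

/-- `∑_{n ≥ 1} x ^ n ∑_e t ^ asc(e)`, with `e` over the `0021`-avoiding inversion sequences of
length `n`, as a power series in `x`. -/
def genFun {R : Type*} [CommRing R] (t : R) : PowerSeries R :=
  PowerSeries.mk fun n =>
    if n = 0 then 0 else ∑ e ∈ avoiding (invSeqs n) ![0, 0, 2, 1], t ^ asc e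

/-- `r` is a power series in `x` with zero constant term and
`r³ - (2 + x + t - x t²) r² + (1 + 2 x) r - x = 0`. -/
def IsKernelRoot {R : Type*} [CommRing R] (t : R) (r : PowerSeries R) : Prop :=
  PowerSeries.constantCoeff r = 0 ∧
    r ^ 3 - (2 + PowerSeries.X + PowerSeries.C t - PowerSeries.X * PowerSeries.C t ^ 2) * r ^ 2
      + (1 + 2 * PowerSeries.X) * r - PowerSeries.X = 0

end InvSeq

end

namespace InvSeq

open PowerSeries Finset

section KernelSeries

variable {R : Type*} [CommRing R]

/-- A map of power series that gains one order of agreement has a fixed point. -/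
theorem exists_fixedPoint_of_contracting (Φ : PowerSeries R → PowerSeries R)
    (hΦ : ∀ n f g, X ^ n ∣ f - g → X ^ (n + 1) ∣ Φ f - Φ g) :
    ∃ f, Φ f = f := by
  have step : ∀ n m, X ^ n ∣ Φ^[n + m] 0 - Φ^[n] 0 := by
    intro n m
    induction n with
    | zero => simp
    | succ n ih =>
      rw [Nat.add_right_comm, Function.iterate_succ_apply', Function.iterate_succ_apply']
      exact hΦ _ _ _ ih
  set V : PowerSeries R := mk fun n => coeff n (Φ^[n + 1] 0) with hV
  have hlim : ∀ n, X ^ n ∣ V - Φ^[n] 0 := by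
    intro n
    rw [X_pow_dvd_iff]
    intro i hi
    obtain ⟨m, rfl⟩ := Nat.exists_eq_add_of_lt hi
    have := X_pow_dvd_iff.1 (step (i + 1) m) i (Nat.lt_succ_self i)
    rw [map_sub, sub_eq_zero] at this ⊢
    rw [hV, coeff_mk, ← this]
    rw [Nat.add_right_comm]
  refine ⟨V, sub_eq_zero.1 (PowerSeries.ext fun n => ?_)⟩
  have h1 := hΦ n _ _ (hlim n)
  rw [← Function.iterate_succ_apply' Φ n] at h1
  have h2 := dvd_sub h1 (hlim (n + 1))
  rw [sub_sub_sub_cancel_right] at h2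
  simpa using X_pow_dvd_iff.1 h2 n (Nat.lt_succ_self n)

/-- The auxiliary series `V`, in terms of which the root of the kernel is `X * (1 + t * X * V)`. -/
theorem exists_auxSeries (t : R) :
    ∃ V : PowerSeries R, ∀ Y r : PowerSeries R, Y = 1 + C t * X * V → r = X * Y →
      V * (1 - r) ^ 2 = Y * (Y - C t * r) := by
  let Φ : PowerSeries R → PowerSeries R := fun V =>
    (1 + C t * X * V) ^ 2 * (1 - C t * X) +
      V * (2 * (X * (1 + C t * X * V)) - (X * (1 + C t * X * V)) ^ 2)
  obtain ⟨V, hV⟩ := exists_fixedPoint_of_contracting Φ (by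
    rintro n f g ⟨d, hd⟩
    obtain rfl := eq_add_of_sub_eq hd
    set f := X ^ n * d + g with hf
    set Yf := 1 + C t * X * f
    set Yg := 1 + C t * X * g
    refine ⟨d * (C t * (Yf + Yg) * (1 - C t * X) + Yf * (2 - X * Yf)
      + g * (2 * C t * X - C t * X ^ 2 * (Yf + Yg))), ?_⟩
    simp only [Φ, Yf, Yg, hf]
    ring)
  refine ⟨V, ?_⟩
  rintro Y r rfl rfl
  simp only [Φ] at hV
  linear_combination -hV

/-- Modulo `X ^ n`, the kernel polynomial has at most one root with zero constant term. -/
theorem dvd_sub_of_dvd_kernel (t : R) (n : ℕ) {p q : PowerSeries R}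
    (hp : constantCoeff p = 0) (hq : constantCoeff q = 0)
    (h : X ^ n ∣
      (p ^ 3 - (2 + X + C t - X * C t ^ 2) * p ^ 2 + (1 + 2 * X) * p - X) -
      (q ^ 3 - (2 + X + C t - X * C t ^ 2) * q ^ 2 + (1 + 2 * X) * q - X)) :
    X ^ n ∣ p - q := by
  have hu : IsUnit (p ^ 2 + p * q + q ^ 2 - (2 + X + C t - X * C t ^ 2) * (p + q)
      + (1 + 2 * X)) := by
    rw [isUnit_iff_constantCoeff]
    simp [hp, hq]
  rw [← hu.dvd_mul_right]
  convert h using 1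
  ring

theorem IsKernelRoot.unique {t : R} {p q : PowerSeries R} (hp : IsKernelRoot t p)
    (hq : IsKernelRoot t q) : p = q := by
  rw [← sub_eq_zero]
  ext n
  have := dvd_sub_of_dvd_kernel t (n + 1) hp.1 hq.1 (by rw [hp.2, hq.2]; simp)
  simpa using X_pow_dvd_iff.1 this n (Nat.lt_succ_self n)

theorem IsKernelRoot.coeffs {t : R} {r : PowerSeries R} (hr : IsKernelRoot t r) :
    coeff 1 r = 1 ∧ coeff 2 r = t ∧ coeff 3 r = t ^ 2 + 2 * t ∧
      coeff 4 r = t ^ 3 + 8 * t ^ 2 + 3 * t ∧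
      coeff 5 r = t ^ 4 + 22 * t ^ 3 + 27 * t ^ 2 + 4 * t := by
  set T : PowerSeries R := C t with hT
  set p : PowerSeries R := C (1 : R) * X ^ 1 + C t * X ^ 2 + C (t ^ 2 + 2 * t) * X ^ 3
    + C (t ^ 3 + 8 * t ^ 2 + 3 * t) * X ^ 4
    + C (t ^ 4 + 22 * t ^ 3 + 27 * t ^ 2 + 4 * t) * X ^ 5 with hp
  have h6 : X ^ 6 ∣ r - p := by
    refine dvd_sub_of_dvd_kernel t 6 hr.1 (by simp [hp]) ?_
    rw [hr.2, zero_sub, dvd_neg]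
    refine ⟨(-5 * T - 66 * T ^ 2 - 136 * T ^ 3 - 52 * T ^ 4 - T ^ 5) +
      X * (4 * T + 7 * T ^ 2 - 128 * T ^ 3 - 146 * T ^ 4 - 8 * T ^ 5 + T ^ 6) +
      X ^ 2 * (-10 * T ^ 2 - 148 * T ^ 3 - 404 * T ^ 4 - 234 * T ^ 5 - 6 * T ^ 6 + T ^
        7) +
      X ^ 3 * (2 * T ^ 2 - 92 * T ^ 3 - 714 * T ^ 4 - 972 * T ^ 5 - 304 * T ^ 6 + T ^ 8)
        +
      X ^ 4 * (16 * T ^ 2 + 115 * T ^ 3 - 234 * T ^ 4 - 1494 * T ^ 5 - 1352 * T ^ 6 -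
        198 * T ^ 7 + 14 * T ^ 8 + T ^ 9) +
      X ^ 5 * (32 * T ^ 2 + 606 * T ^ 3 + 3191 * T ^ 4 + 5488 * T ^ 5 + 3880 * T ^ 6 +
        1596 * T ^ 7 + 552 * T ^ 8 + 44 * T ^ 9 + T ^ 10) +
      X ^ 6 * (219 * T ^ 3 + 2292 * T ^ 4 + 7428 * T ^ 5 + 8432 * T ^ 6 + 3411 * T ^ 7 +
        348 * T ^ 8 + 10 * T ^ 9) +
      X ^ 7 * (204 * T ^ 3 + 2649 * T ^ 4 + 11400 * T ^ 5 + 18948 * T ^ 6 + 12888 * T ^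
        7 + 3225 * T ^ 8 + 252 * T ^ 9 + 6 * T ^ 10) +
      X ^ 8 * (144 * T ^ 3 + 2328 * T ^ 4 + 13377 * T ^ 5 + 33132 * T ^ 6 + 36261 * T ^
        7 + 16896 * T ^ 8 + 2679 * T ^ 9 + 156 * T ^ 10 + 3 * T ^ 11) +
      X ^ 9 * (64 * T ^ 3 + 1296 * T ^ 4 + 9804 * T ^ 5 + 33987 * T ^ 6 + 54570 * T ^ 7
        + 41919 * T ^ 8 + 14224 * T ^ 9 + 1533 * T ^ 10 + 66 * T ^ 11 + T ^ 12), ?_⟩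
    simp only [hp, map_add, map_mul, map_pow, map_one, map_ofNat, ← hT]
    ring
  have hcoeff : ∀ i < 6, ∀ a b c d e : R, coeff i (C a * X ^ 1 + C b * X ^ 2 + C c * X ^ 3
      + C d * X ^ 4 + C e * X ^ 5) = ![0, a, b, c, d, e] (Fin.ofNat 6 i) := by
    intro i hi a b c d e
    simp only [map_add, coeff_C_mul_X_pow]
    interval_cases i <;> first | (simp; done) | (simp; rfl)
  have key : ∀ i < 6, coeff i r = coeff i p := fun i hi => by
    simpa [sub_eq_zero] using X_pow_dvd_iff.1 h6 i hi
  refine ⟨?_, ?_, ?_, ?_, ?_⟩ <;> rw [key _ (by norm_num), hp, hcoeff _ (by norm_num)] <;> rfl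

theorem isKernelRoot_of_auxSeries {t : R} {V Y r : PowerSeries R} (hY : Y = 1 + C t * X * V)
    (hr : r = X * Y) (hV : V * (1 - r) ^ 2 = Y * (Y - C t * r)) : IsKernelRoot t r := by
  refine ⟨by simp [hr], ?_⟩
  subst hr hY
  linear_combination C t * X ^ 2 * hV

end KernelSeries


section GeneratingFunctions

variable {R : Type*} [CommRing R]

theorem sum_antidiagonal_range {M : Type*} [AddCommMonoid M] (N : ℕ) (F : ℕ → ℕ → ℕ → M) :
    ∑ x ∈ antidiagonal N, ∑ a ∈ range (x.2 + 1), F x.1 a (x.2 - a) =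
      ∑ y ∈ antidiagonal N, ∑ x ∈ antidiagonal y.1, F x.1 x.2 y.2 := by
  have h : ∀ x ∈ antidiagonal N, ∑ a ∈ range (x.2 + 1), F x.1 a (x.2 - a) =
      ∑ y ∈ antidiagonal x.2, F x.1 y.1 y.2 := fun x _ =>
    (Nat.sum_antidiagonal_eq_sum_range_succ (fun a d => F x.1 a d) x.2).symm
  rw [sum_congr rfl h, sum_sigma', sum_sigma']
  refine sum_nbij' (fun x => ⟨(x.1.1 + x.2.1, x.2.2), (x.1.1, x.2.1)⟩)
    (fun y => ⟨(y.2.1, y.2.2 + y.1.2), (y.2.2, y.1.2)⟩) ?_ ?_ ?_ ?_ ?_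
  all_goals
    rintro ⟨⟨i, j⟩, ⟨k, l⟩⟩
    simp only [mem_sigma, HasAntidiagonal.mem_antidiagonal]
    rintro ⟨h1, h2⟩
    subst h2
    subst h1
    simp [add_assoc]

theorem sum_antidiagonal_pow_mul (t : R) (N : ℕ) (F : ℕ → ℕ → ℕ → R) :
    ∑ x ∈ antidiagonal N, t ^ x.2 * ∑ a ∈ range (x.2 + 1), F x.1 a (x.2 - a) =
      ∑ y ∈ antidiagonal N, t ^ y.2 * ∑ x ∈ antidiagonal y.1, t ^ x.2 * F x.1 x.2 y.2 := by
  have h := sum_antidiagonal_range N fun m a d => t ^ (a + d) * F m a d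
  simp only [mul_sum]
  convert h using 2 with x _ x _
  · refine sum_congr rfl fun b hb => ?_
    rw [Nat.add_sub_cancel' (Nat.lt_succ_iff.1 (mem_range.1 hb))]
  · refine sum_congr rfl fun y _ => ?_
    ring

theorem coeff_of_mul_eq_one {t : R} {u : PowerSeries R} (hu : u * (1 - C t * X) = 1) (N : ℕ) :
    coeff N u = t ^ N := by
  have h : u = 1 + X * (C t * u) := by linear_combination hu
  induction N with
  | zero => rw [h]; simp
  | succ N ih => rw [h, map_add, coeff_succ_X_mul, coeff_C_mul, ih]; simp [pow_succ', coeff_one]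

theorem coeff_mul_pow_mul_of_mul_eq_one {t : R} {f Y u : PowerSeries R}
    (hu : u * (1 - C t * X * Y) = 1) (N k : ℕ) :
    coeff N (f * Y ^ k * u) =
      ∑ y ∈ antidiagonal N, t ^ y.2 * coeff y.1 (f * Y ^ (k + y.2)) := by
  have hrec : ∀ k, f * Y ^ k * u = f * Y ^ k + X * (C t * (f * Y ^ (k + 1) * u)) := fun k => by
    linear_combination f * Y ^ k * hu
  induction N generalizing k with
  | zero => rw [hrec]; simp
  | succ N ih =>
    rw [hrec, map_add, coeff_succ_X_mul, coeff_C_mul, ih, Nat.sum_antidiagonal_succ',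
      mul_sum]
    simp [pow_succ', mul_assoc, add_assoc, add_comm 1]

variable {t : R} {G H : ℕ → ℕ → ℕ → R} {V Y r i₁ i₂ : PowerSeries R}

/-- The coefficients of the series solving the recurrences for the families `G` and `H`. -/
theorem sum_antidiagonal_eq_coeff
    (hG0 : ∀ q a, G 0 q a = 1) (hH0 : ∀ q a, H 0 q a = 1)
    (hG : ∀ n q a, G (n + 1) q a =
      ∑ b ∈ range (a + 1), G n (q + 1 + (a - b)) b + t * ∑ d ∈ range q, H n (q + 1 - d) a)
    (hH : ∀ n k a, H (n + 1) (k + 1) a = G (n + 1) (k + 1) a + (1 - t) * H n (k + 2) a)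
    (hY : Y = 1 + C t * X * V) (hr : r = X * Y) (hV : V * (1 - r) ^ 2 = Y * (Y - C t * r))
    (h₁ : i₁ * (1 - C t * X) = 1) (h₂ : i₂ * (1 - C t * X * Y) = 1) (N k : ℕ) :
    ∑ x ∈ antidiagonal N, t ^ x.2 * G x.1 (k + 2) x.2 =
        coeff N (V * (1 - (1 - C t) * r) * i₁ * Y ^ k) ∧
      ∑ x ∈ antidiagonal N, t ^ x.2 * H x.1 (k + 2) x.2 = coeff N (V * i₁ * Y ^ k) := by
  set A := V * (1 - (1 - C t) * r) * i₁ with hA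
  set B := V * i₁ with hB
  have hi₁ := coeff_of_mul_eq_one h₁
  have idB : ∀ k, B * Y ^ k = A * Y ^ k + X * (C (1 - t) * (B * Y ^ (k + 1))) := fun k => by
    simp only [hA, hB, hr, map_sub, map_one]
    ring
  have key : V * (1 - (1 - C t) * r) * (1 - C t * r - r) = Y ^ 2 * (1 - C t * r) := by
    rw [hr] at hV ⊢
    linear_combination hV + C t * X * Y ^ 2 * hY
  have idA : ∀ k, A * Y ^ k = i₁ + X * (A * Y ^ (k + 1) * i₂
      + C t * ∑ d ∈ range (k + 2), B * Y ^ (k + 1 - d)) := fun k => by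
    have hrefl : ∑ d ∈ range (k + 2), Y ^ (k + 1 - d) = ∑ j ∈ range (k + 2), Y ^ j :=
      Finset.sum_range_reflect (fun j => Y ^ j) (k + 2)
    rw [← mul_sum, hrefl]
    have hg := geom_sum_mul Y (k + 2)
    have e1 : A = i₁ * Y ^ 2 + X * (A * Y * i₂) := by
      rw [hr] at key
      simp only [hA, hr]
      linear_combination i₁ * i₂ * key + (i₁ * Y ^ 2 - i₁ * V * (1 - (1 - C t) * (X * Y))) * h₂
    rw [hB]
    linear_combination Y ^ k * e1 - i₁ * hg + i₁ * (∑ j ∈ range (k + 2), Y ^ j) * hY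
  induction N using Nat.strong_induction_on generalizing k with
  | _ N ih =>
  have hGN : ∑ x ∈ antidiagonal N, t ^ x.2 * G x.1 (k + 2) x.2 = coeff N (A * Y ^ k) := by
    rw [idA]
    cases N with
    | zero => rw [map_add, hi₁, coeff_zero_X_mul]; simp [hG0]
    | succ N =>
      rw [Nat.sum_antidiagonal_succ, hG0, map_add, hi₁, coeff_succ_X_mul, map_add,
        coeff_mul_pow_mul_of_mul_eq_one h₂, coeff_C_mul, map_sum, mul_one]
      congr 1
      simp only [hG, mul_add, sum_add_distrib]
      congr 1
      · rw [sum_antidiagonal_pow_mul t N fun m a d => G m (k + 2 + 1 + d) a]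
        refine sum_congr rfl fun y hy => ?_
        rw [← (ih y.1 (by have := HasAntidiagonal.mem_antidiagonal.1 hy; omega) (k + 1 + y.2)).1,
          show k + 1 + y.2 + 2 = k + 2 + 1 + y.2 by omega]
      · simp only [mul_sum]
        rw [sum_comm]
        refine sum_congr rfl fun d hd => ?_
        rw [← (ih N (Nat.lt_succ_self N) (k + 1 - d)).2, mul_sum]
        refine sum_congr rfl fun x _ => ?_
        have := mem_range.1 hd
        rw [show k + 2 + 1 - d = k + 1 - d + 2 by omega]
        ring
  refine ⟨hGN, ?_⟩
  rw [idB, map_add, ← hGN]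
  cases N with
  | zero => simp [hG0, hH0]
  | succ N =>
    rw [coeff_succ_X_mul, coeff_C_mul, ← (ih N (Nat.lt_succ_self N) (k + 1)).2,
      Nat.sum_antidiagonal_succ, Nat.sum_antidiagonal_succ, hG0, hH0]
    simp only [hH, mul_add, sum_add_distrib, mul_sum, add_assoc]
    congr 2
    refine sum_congr rfl fun x _ => ?_
    ring

/-- The total over the length of the initial ascending run. -/
theorem eq_mul_inverse_of_coeff {F : PowerSeries R}
    (hG0 : ∀ q a, G 0 q a = 1) (hH0 : ∀ q a, H 0 q a = 1)
    (hG : ∀ n q a, G (n + 1) q a =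
      ∑ b ∈ range (a + 1), G n (q + 1 + (a - b)) b + t * ∑ d ∈ range q, H n (q + 1 - d) a)
    (hH : ∀ n k a, H (n + 1) (k + 1) a = G (n + 1) (k + 1) a + (1 - t) * H n (k + 2) a)
    (hY : Y = 1 + C t * X * V) (hr : r = X * Y) (hV : V * (1 - r) ^ 2 = Y * (Y - C t * r))
    (hF0 : coeff 0 F = 0) (hF1 : coeff 1 F = 1)
    (hF : ∀ N, coeff (N + 2) F = t ^ (N + 1) + ∑ x ∈ antidiagonal N,
      t ^ x.2 * ∑ a ∈ range (x.2 + 1), G x.1 (x.2 - a + 2) a) :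
    F = r * Ring.inverse (1 - r) := by
  obtain ⟨i₁, h₁⟩ : ∃ i₁, i₁ * (1 - C t * X) = 1 := by
    have : IsUnit (1 - C t * X) := by rw [isUnit_iff_constantCoeff]; simp
    exact this.exists_left_inv
  obtain ⟨i₂, h₂⟩ : ∃ i₂, i₂ * (1 - C t * X * Y) = 1 := by
    have : IsUnit (1 - C t * X * Y) := by rw [isUnit_iff_constantCoeff]; simp
    exact this.exists_left_inv
  have hu : IsUnit (1 - r) := by rw [isUnit_iff_constantCoeff]; simp [hr]
  have hpow := coeff_of_mul_eq_one h₁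
  set A := V * (1 - (1 - C t) * r) * i₁ with hA
  have hFA : F = X * (i₁ + X * (A * Y ^ 0 * i₂)) := by
    ext N
    rcases N with _ | _ | N
    · rw [hF0]; simp
    · rw [hF1, coeff_succ_X_mul, map_add, hpow, coeff_zero_X_mul]; simp
    · rw [hF, coeff_succ_X_mul, map_add, coeff_succ_X_mul, hpow,
        coeff_mul_pow_mul_of_mul_eq_one h₂]
      congr 1
      rw [sum_antidiagonal_pow_mul t N fun m a d => G m (d + 2) a]
      refine sum_congr rfl fun y _ => ?_
      rw [zero_add, ← (sum_antidiagonal_eq_coeff hG0 hH0 hG hH hY hr hV h₁ h₂ y.1 y.2).1]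
  have hmain : F * (1 - r) = r := by
    have e : ((1 - C t * r) + X * V * (1 - (1 - C t) * r)) * (1 - r) =
        Y * (1 - C t * r) * (1 - C t * X) := by
      rw [hr] at hV ⊢
      linear_combination (1 - C t) * X * hV - (1 - X * Y) * hY
    rw [hFA, hA, pow_zero]
    rw [hr] at e ⊢
    linear_combination X * i₁ * i₂ * e - X * i₁ * (1 - X * Y) * h₂
      + X * Y * (i₂ * (1 - C t * X * Y) * h₁ + h₂)
  calc F = F * ((1 - r) * Ring.inverse (1 - r)) := by rw [Ring.mul_inverse_cancel _ hu, mul_one]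
    _ = r * Ring.inverse (1 - r) := by rw [← mul_assoc, hmain]

end GeneratingFunctions


section Patterns

theorem contains_021_iff {n : ℕ} {w : Fin n → ℕ} :
    Contains w ![0, 2, 1] ↔ ∃ i j k, i < j ∧ j < k ∧ w i < w k ∧ w k < w j := by
  constructor
  · rintro ⟨f, hf⟩
    exact ⟨f 0, f 1, f 2, f.lt_iff_lt.2 (by decide), f.lt_iff_lt.2 (by decide),
      (hf 0 2).2 (by decide), (hf 2 1).2 (by decide)⟩
  · rintro ⟨i, j, k, hij, hjk, hik, hkj⟩
    refine ⟨OrderEmbedding.ofStrictMono ![i, j, k] ?_, ?_⟩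
    · rw [Fin.strictMono_iff_lt_succ]
      intro a
      fin_cases a <;> simpa
    · intro a b
      fin_cases a <;> fin_cases b <;> simp <;> omega

theorem contains_0021_iff {n : ℕ} {w : Fin n → ℕ} :
    Contains w ![0, 0, 2, 1] ↔
      ∃ h i j k, h < i ∧ i < j ∧ j < k ∧ w h = w i ∧ w i < w k ∧ w k < w j := by
  constructor
  · rintro ⟨f, hf⟩
    refine ⟨f 0, f 1, f 2, f 3, f.lt_iff_lt.2 (by decide), f.lt_iff_lt.2 (by decide),
      f.lt_iff_lt.2 (by decide), ?_, (hf 1 3).2 (by decide), (hf 3 2).2 (by decide)⟩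
    have h1 := (hf 0 1).not.2 (by decide)
    have h2 := (hf 1 0).not.2 (by decide)
    omega
  · rintro ⟨h, i, j, k, hhi, hij, hjk, e, hik, hkj⟩
    refine ⟨OrderEmbedding.ofStrictMono ![h, i, j, k] ?_, ?_⟩
    · rw [Fin.strictMono_iff_lt_succ]
      intro a
      fin_cases a <;> simpa
    · intro a b
      fin_cases a <;> fin_cases b <;> simp <;> omega

theorem avoids_021_iff {n : ℕ} {w : Fin n → ℕ} :
    Avoids w ![0, 2, 1] ↔ ∀ i j k, i < j → j < k → w i < w k → w j ≤ w k := by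
  rw [Avoids, contains_021_iff]
  push Not
  rfl

theorem avoids_comp_strictMono {n k : ℕ} {w : Fin n → ℕ} {P : Fin k → ℕ} {g : ℕ → ℕ}
    (hg : StrictMono g) : Avoids (fun i => g (w i)) P ↔ Avoids w P := by
  simp only [Avoids, Contains, hg.lt_iff_lt]

theorem avoids_cons_iff {n a : ℕ} {w : Fin n → ℕ} :
    Avoids (Matrix.vecCons a w) ![0, 2, 1] ↔
      Avoids w ![0, 2, 1] ∧ ∀ j k, j < k → a < w k → w j ≤ w k := by
  simp only [avoids_021_iff, Fin.forall_fin_succ (n := n), Matrix.cons_val_zero,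
    Matrix.cons_val_succ, Fin.succ_lt_succ_iff, Fin.not_lt_zero, Fin.succ_pos, lt_self_iff_false]
  simp
  tauto

theorem avoids_cons_cons_iff_of_le {n a v : ℕ} {w : Fin n → ℕ} (hv : v ≤ a) :
    Avoids (Matrix.vecCons a (Matrix.vecCons v w)) ![0, 2, 1] ↔
      Avoids (Matrix.vecCons v w) ![0, 2, 1] := by
  rw [avoids_cons_iff, and_iff_left_iff_imp, avoids_cons_iff]
  rintro ⟨-, h⟩
  simp only [Fin.forall_fin_succ (n := n), Matrix.cons_val_zero, Matrix.cons_val_succ,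
    Fin.succ_lt_succ_iff]
  refine ⟨⟨by simp, fun k _ hk => by omega⟩, fun j => ⟨by simp, fun k hjk hk => h j k hjk ?_⟩⟩
  omega

theorem avoids_cons_cons_iff_of_lt {n a v : ℕ} {w : Fin n → ℕ} (hv : a < v) :
    Avoids (Matrix.vecCons a (Matrix.vecCons v w)) ![0, 2, 1] ↔
      Avoids (Matrix.vecCons a w) ![0, 2, 1] ∧ ∀ k, a < w k → v ≤ w k := by
  rw [avoids_cons_iff, avoids_cons_iff, avoids_cons_iff]
  simp only [Fin.forall_fin_succ (n := n), Matrix.cons_val_zero, Matrix.cons_val_succ,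
    Fin.succ_lt_succ_iff]
  constructor
  · rintro ⟨⟨h1, -⟩, ⟨-, h2⟩, h3⟩
    exact ⟨⟨h1, fun j k => (h3 j).2 k⟩, fun k => h2 k (Fin.succ_pos _)⟩
  · rintro ⟨⟨h1, h2⟩, h3⟩
    exact ⟨⟨h1, fun j k hjk hk => h2 j k hjk (hv.trans hk)⟩, ⟨by simp, fun k _ => h3 k⟩,
      fun j => ⟨by simp, h2 j⟩⟩

end Patterns

section Ascents

open Classical in
theorem asc_eq_sum {n : ℕ} (w : Fin n → ℕ) :
    asc w = ∑ i : Fin n, if ∃ h : (i : ℕ) + 1 < n, w i < w ⟨(i : ℕ) + 1, h⟩ then 1 else 0 := by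
  rw [asc, card_filter]

theorem asc_of_length_one (w : Fin 1 → ℕ) : asc w = 0 := by
  rw [asc_eq_sum]
  refine sum_eq_zero fun i _ => if_neg ?_
  rintro ⟨h, -⟩
  omega

theorem asc_cons_cons {n : ℕ} (a v : ℕ) (w : Fin n → ℕ) :
    asc (Matrix.vecCons a (Matrix.vecCons v w)) =
      (if a < v then 1 else 0) + asc (Matrix.vecCons v w) := by
  rw [asc_eq_sum, Fin.sum_univ_succ, asc_eq_sum]
  congr 1
  · simp
  · refine sum_congr rfl fun i _ => if_congr ?_ rfl rfl
    exact ⟨fun ⟨h, h'⟩ => ⟨Nat.lt_of_succ_lt_succ h, h'⟩, fun ⟨h, h'⟩ => ⟨Nat.succ_lt_succ h, h'⟩⟩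

theorem asc_comp_strictMono {n : ℕ} (w : Fin n → ℕ) {g : ℕ → ℕ} (hg : StrictMono g) :
    asc (fun i => g (w i)) = asc w := by
  simp only [asc, hg.lt_iff_lt]

theorem asc_id (n : ℕ) : asc (fun i : Fin (n + 1) => (i : ℕ)) = n := by
  rw [asc_eq_sum, Fin.sum_univ_castSucc]
  simp

theorem asc_of_initial_run {n p : ℕ} {e : Fin (p + 1 + n) → ℕ}
    (he : ∀ i : Fin (p + 1 + n), (i : ℕ) < p + 1 → e i = i)
    (hp : ∀ h : p + 1 < p + 1 + n, e ⟨p + 1, h⟩ < p + 1) :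
    asc e = p + asc fun i : Fin n => e (Fin.natAdd (p + 1) i) := by
  rw [asc_eq_sum, Fin.sum_univ_add]
  refine (congrArg₂ (· + ·) (?_ : _ = asc fun i : Fin (p + 1) => (i : ℕ)) ?_).trans
    (by rw [asc_id])
  · rw [asc_eq_sum]
    refine sum_congr rfl fun i _ => if_congr ?_ rfl rfl
    have hi := i.isLt
    simp only [Fin.val_castAdd, he (Fin.castAdd n i) hi]
    constructor
    · rintro ⟨h, h'⟩
      refine ⟨?_, by omega⟩
      by_contra hc
      obtain h2 : (i : ℕ) = p := by omega
      have := hp (by omega)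
      simp only [h2] at h'
      omega
    · rintro ⟨h, -⟩
      refine ⟨by omega, ?_⟩
      rw [he ⟨i + 1, by omega⟩ h]
      exact Nat.lt_succ_self _
  · rw [asc_eq_sum]
    refine sum_congr rfl fun i _ => if_congr ?_ rfl rfl
    simp only [Fin.val_natAdd]
    exact ⟨fun ⟨_, h⟩ => ⟨by omega, h⟩, fun ⟨_, h⟩ => ⟨by omega, h⟩⟩

end Ascents

section Decomposition

open Classical in
/-- The words of length `n` that may follow a letter `a` in a word avoiding `021`, where the first
of them has `q` possible values above `a`. -/
noncomputable def continuations (n q a : ℕ) : Finset (Fin n → ℕ) :=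
  (sInvSeqs fun i => a + 1 + q + (i : ℕ)).filter fun w => Avoids (Matrix.vecCons a w) ![0, 2, 1]

theorem mem_continuations {n q a : ℕ} {w : Fin n → ℕ} : w ∈ continuations n q a ↔
    (∀ i, w i < a + 1 + q + (i : ℕ)) ∧ Avoids (Matrix.vecCons a w) ![0, 2, 1] := by
  simp [continuations, sInvSeqs]

/-- The strictly increasing map that leaves `0, …, a` fixed and adds `d` to the other numbers. -/
def shiftAbove (a d x : ℕ) : ℕ := if x ≤ a then x else x + d

theorem shiftAbove_strictMono (a d : ℕ) : StrictMono (shiftAbove a d) := by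
  intro x y h
  unfold shiftAbove
  split_ifs <;> omega

theorem cons_shiftAbove {n : ℕ} (a d : ℕ) (w : Fin n → ℕ) :
    Matrix.vecCons a (fun i => shiftAbove a d (w i)) =
      fun i => shiftAbove a d (Matrix.vecCons a w i) := by
  ext i
  refine Fin.cases ?_ (fun i => ?_) i <;> simp [shiftAbove]

theorem asc_cons_shiftAbove {n : ℕ} (a d : ℕ) (w : Fin n → ℕ) :
    asc (Matrix.vecCons (a + 1 + d) fun i => shiftAbove a d (w i)) =
      asc (Matrix.vecCons (a + 1) w) := by
  rw [← asc_comp_strictMono (Matrix.vecCons (a + 1) w) (shiftAbove_strictMono a d)]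
  congr 1
  ext i
  refine Fin.cases ?_ (fun i => ?_) i <;> simp [shiftAbove]

variable {M : Type*} [AddCommMonoid M]

open Classical in
theorem sum_sInvSeqs_succ_filter {n : ℕ} (s : Fin (n + 1) → ℕ) (p : (Fin (n + 1) → ℕ) → Prop)
    (f : (Fin (n + 1) → ℕ) → M) :
    ∑ w ∈ sInvSeqs s with p w, f w =
      ∑ v ∈ range (s 0), ∑ w ∈ sInvSeqs (fun i => s i.succ) with p (Matrix.vecCons v w),
        f (Matrix.vecCons v w) := by
  rw [sum_sigma']
  refine sum_nbij' (fun w => ⟨w 0, fun i => w i.succ⟩) (fun x => Matrix.vecCons x.1 x.2)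
    ?_ ?_ ?_ ?_ ?_
  · intro w
    have : Matrix.vecCons (w 0) (fun i => w i.succ) = w := Matrix.cons_head_tail w
    simp only [sInvSeqs, mem_filter, Fintype.mem_piFinset, mem_range, mem_sigma, this]
    exact fun h => ⟨h.1 0, fun i => h.1 _, h.2⟩
  · rintro ⟨v, w⟩
    simp only [sInvSeqs, mem_filter, Fintype.mem_piFinset, mem_range, mem_sigma]
    exact fun h => ⟨Fin.cases h.1 h.2.1, h.2.2⟩
  · exact fun w _ => Matrix.cons_head_tail w
  · rintro ⟨v, w⟩ _
    simp
  · intro w _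
    exact congrArg f (Matrix.cons_head_tail w).symm

theorem sum_continuations_succ (n q a : ℕ) (f : (Fin (n + 1) → ℕ) → M) :
    ∑ w ∈ continuations (n + 1) q a, f w =
      ∑ b ∈ range (a + 1), ∑ w ∈ continuations n (q + 1 + (a - b)) b, f (Matrix.vecCons b w) +
      ∑ d ∈ range q, ∑ w ∈ continuations n (q + 1 - d) a,
        f (Matrix.vecCons (a + 1 + d) fun i => shiftAbove a d (w i)) := by
  classical
  rw [continuations, sum_sInvSeqs_succ_filter]
  simp only [Fin.val_zero, add_zero, Fin.val_succ]
  rw [sum_range_add]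
  congr 1
  · refine sum_congr rfl fun b hb => sum_congr ?_ fun _ _ => rfl
    have hb := mem_range.1 hb
    ext w
    rw [mem_continuations, mem_filter, avoids_cons_cons_iff_of_le (by omega)]
    simp only [sInvSeqs, Fintype.mem_piFinset, mem_range]
    refine and_congr_left' (forall_congr' fun i => ?_)
    omega
  · refine sum_congr rfl fun d hd => Eq.symm ?_
    have hd := mem_range.1 hd
    refine sum_nbij' (fun w i => shiftAbove a d (w i))
      (fun w i => if w i ≤ a then w i else w i - d) ?_ ?_ ?_ ?_ ?_
    · intro w hw
      obtain ⟨h1, h2⟩ := mem_continuations.1 hw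
      rw [mem_filter, avoids_cons_cons_iff_of_lt (by omega), cons_shiftAbove,
        avoids_comp_strictMono (shiftAbove_strictMono a d)]
      simp only [sInvSeqs, Fintype.mem_piFinset, mem_range]
      refine ⟨fun i => ?_, h2, fun k => ?_⟩
      · have := h1 i
        unfold shiftAbove
        split_ifs <;> omega
      · unfold shiftAbove
        split_ifs <;> omega
    · intro w hw
      rw [mem_filter, avoids_cons_cons_iff_of_lt (by omega)] at hw
      simp only [sInvSeqs, Fintype.mem_piFinset, mem_range] at hw
      obtain ⟨h1, h2, h3⟩ := hw
      rw [mem_continuations]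
      refine ⟨fun i => ?_, ?_⟩
      · have := h1 i
        split_ifs <;> omega
      · rw [← avoids_comp_strictMono (shiftAbove_strictMono a d), ← cons_shiftAbove]
        convert h2 using 3 with i
        have := h3 i
        unfold shiftAbove
        split_ifs <;> omega
    · intro w _
      ext i
      simp only [shiftAbove]
      split_ifs <;> omega
    · intro w hw
      rw [mem_filter, avoids_cons_cons_iff_of_lt (by omega)] at hw
      ext i
      have := hw.2.2 i
      simp only [shiftAbove]
      split_ifs <;> omega
    · exact fun _ _ => rfl

theorem sum_avoiding_invSeqsFrom (n p : ℕ) (f : (Fin (n + 1) → ℕ) → M) :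
    ∑ w ∈ avoiding (invSeqsFrom (n + 1) (p + 1)) ![0, 2, 1], f w =
      ∑ a ∈ range (p + 1), ∑ w ∈ continuations n (p - a + 2) a, f (Matrix.vecCons a w) := by
  classical
  rw [avoiding, invSeqsFrom]
  convert sum_sInvSeqs_succ_filter (n := n) _ _ f using 1
  refine sum_congr (by simp) fun a ha => sum_congr ?_ fun _ _ => rfl
  have ha : a < p + 1 := by simpa using ha
  ext w
  rw [mem_continuations, mem_filter]
  simp only [sInvSeqs, Fintype.mem_piFinset, mem_range, Fin.val_succ, Nat.succ_ne_zero, if_false]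
  refine and_congr_left' (forall_congr' fun i => ?_)
  omega

end Decomposition

section WeightedSums

variable {R : Type*} [CommRing R]

/-- The sum of `t ^ asc (c w)` over the continuations `w` of `a`. -/
noncomputable def contSum (t : R) (c n q a : ℕ) : R :=
  ∑ w ∈ continuations n q a, t ^ asc (Matrix.vecCons c w)

theorem contSum_zero (t : R) (c q a : ℕ) : contSum t c 0 q a = 1 := by
  have h : continuations 0 q a = {![]} := by
    ext w
    simp only [mem_continuations, avoids_021_iff, mem_singleton]
    exact ⟨fun _ => Subsingleton.elim _ _, fun _ => ⟨fun i => i.elim0, by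
      intro i j _ hij
      omega⟩⟩
  simp [contSum, h, asc_of_length_one]

theorem contSum_succ (t : R) (n q a : ℕ) : contSum t a (n + 1) q a =
    ∑ b ∈ range (a + 1), contSum t b n (q + 1 + (a - b)) b +
      t * ∑ d ∈ range q, contSum t (a + 1) n (q + 1 - d) a := by
  rw [contSum, sum_continuations_succ, mul_sum]
  congr 1
  · refine sum_congr rfl fun b hb => sum_congr rfl fun w _ => ?_
    have := mem_range.1 hb
    rw [asc_cons_cons, if_neg (by omega), zero_add]
  · refine sum_congr rfl fun d _ => ?_
    rw [contSum, mul_sum]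
    refine sum_congr rfl fun w _ => ?_
    rw [asc_cons_cons, if_pos (by omega), asc_cons_shiftAbove, pow_add, pow_one]

theorem contSum_add_one_succ (t : R) (n k a : ℕ) : contSum t (a + 1) (n + 1) (k + 1) a =
    contSum t a (n + 1) (k + 1) a + (1 - t) * contSum t (a + 1) n (k + 2) a := by
  rw [contSum_succ, contSum, sum_continuations_succ, sum_range_succ' _ k, sum_range_succ' _ k,
    mul_add, mul_sum]
  have h1 : ∑ b ∈ range (a + 1), ∑ w ∈ continuations n (k + 1 + 1 + (a - b)) b,
      t ^ asc (Matrix.vecCons (a + 1) (Matrix.vecCons b w)) =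
      ∑ b ∈ range (a + 1), contSum t b n (k + 1 + 1 + (a - b)) b := by
    refine sum_congr rfl fun b hb => sum_congr rfl fun w _ => ?_
    have := mem_range.1 hb
    rw [asc_cons_cons, if_neg (by omega), zero_add]
  have h2 : ∀ d, ∑ w ∈ continuations n (k + 1 + 1 - (d + 1)) a,
      t ^ asc (Matrix.vecCons (a + 1) (Matrix.vecCons (a + 1 + (d + 1))
        fun i => shiftAbove a (d + 1) (w i))) =
      t * contSum t (a + 1) n (k + 1 + 1 - (d + 1)) a := fun d => by
    rw [contSum, mul_sum]
    refine sum_congr rfl fun w _ => ?_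
    rw [asc_cons_cons, if_pos (by omega), asc_cons_shiftAbove, pow_add, pow_one]
  have h3 : ∑ w ∈ continuations n (k + 1 + 1 - 0) a,
      t ^ asc (Matrix.vecCons (a + 1) (Matrix.vecCons (a + 1 + 0)
        fun i => shiftAbove a 0 (w i))) = contSum t (a + 1) n (k + 2) a := by
    refine sum_congr rfl fun w _ => ?_
    rw [asc_cons_cons, if_neg (by omega), zero_add, asc_cons_shiftAbove]
  rw [h1, h3, sum_congr rfl fun d _ => h2 d]
  simp only [Nat.sub_zero]
  ring

end WeightedSums


section InitialRun

theorem mem_avoiding {n k : ℕ} {S : Finset (Fin n → ℕ)} {P : Fin k → ℕ} {e : Fin n → ℕ} :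
    e ∈ avoiding S P ↔ e ∈ S ∧ Avoids e P := by
  simp [avoiding]

theorem mem_invSeqs {n : ℕ} {e : Fin n → ℕ} : e ∈ invSeqs n ↔ ∀ i, e i < (i : ℕ) + 1 := by
  simp [invSeqs, sInvSeqs]

theorem mem_invSeqsFrom {n p : ℕ} {e : Fin n → ℕ} :
    e ∈ invSeqsFrom n p ↔ ∀ i, e i < if (i : ℕ) = 0 then p else p + (i : ℕ) + 1 := by
  simp [invSeqsFrom, sInvSeqs]

/-- Deleting the initial ascending run. -/
theorem bijOn_drop_initial_run {n p : ℕ} (hn : 1 ≤ n) :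
    Set.BijOn (fun (e : Fin (p + n) → ℕ) (i : Fin n) => e (Fin.natAdd p i))
      {e | e ∈ avoiding (invSeqs (p + n)) ![0, 0, 2, 1] ∧ iar e = p}
      {e | e ∈ avoiding (invSeqsFrom n p) ![0, 2, 1]} := by
  refine ⟨?_, ?_, ?_⟩
  · rintro e ⟨he, hp⟩
    obtain ⟨he, hav⟩ := mem_avoiding.1 he
    obtain ⟨-, hid, hlt⟩ := (iar_eq_iff he p).1 hp
    specialize hlt (by omega)
    rw [mem_invSeqs] at he
    refine mem_avoiding.2 ⟨mem_invSeqsFrom.2 fun i => ?_, ?_⟩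
    · dsimp only
      split_ifs with hi
      · convert hlt using 2
        ext
        simp [hi]
      · simpa using he (Fin.natAdd p i)
    · rw [Avoids, contains_021_iff]
      rintro ⟨i, j, k, hij, hjk, hik, hkj⟩
      refine hav (contains_0021_iff.2 ?_)
      dsimp only at hik hkj
      have hij' : (i : ℕ) < j := hij
      have hjk' : (j : ℕ) < k := hjk
      by_cases hv : e (Fin.natAdd p i) < p
      · refine ⟨⟨e (Fin.natAdd p i), by omega⟩, Fin.natAdd p i, Fin.natAdd p j, Fin.natAdd p k,
          ?_, ?_, ?_, hid _ hv, hik, hkj⟩ <;> simp only [Fin.lt_def, Fin.val_natAdd] <;> omega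
      · refine ⟨⟨e ⟨p, by omega⟩, by omega⟩, ⟨p, by omega⟩, Fin.natAdd p j, Fin.natAdd p k,
          ?_, ?_, ?_, hid _ hlt, by omega, hkj⟩ <;>
          simp only [Fin.lt_def, Fin.val_natAdd] <;> omega
  · rintro e ⟨he, hp⟩ e' ⟨he', hp'⟩ h
    have h1 := ((iar_eq_iff (mem_avoiding.1 he).1 p).1 hp).2.1
    have h2 := ((iar_eq_iff (mem_avoiding.1 he').1 p).1 hp').2.1
    ext i
    refine Fin.addCases (fun i => ?_) (fun i => congrFun h i) i
    rw [h1 _ (by simp), h2 _ (by simp)]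
  · intro f hf
    obtain ⟨hf, hav⟩ := mem_avoiding.1 hf
    rw [mem_invSeqsFrom] at hf
    set e : Fin (p + n) → ℕ := Fin.append (fun i => (i : ℕ)) f with he
    have hl : ∀ i : Fin p, e (Fin.castAdd n i) = i := fun i => Fin.append_left _ _ i
    have hr : ∀ i : Fin n, e (Fin.natAdd p i) = f i := fun i => Fin.append_right _ _ i
    have hid : ∀ i : Fin (p + n), (i : ℕ) < p → e i = i := fun i hi => hl ⟨i, hi⟩
    have hmem : e ∈ invSeqs (p + n) := by
      rw [mem_invSeqs]
      intro i
      refine Fin.addCases (fun i => ?_) (fun i => ?_) i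
      · rw [hl]
        simp
      · rw [hr, Fin.val_natAdd]
        have := hf i
        split_ifs at this <;> omega
    have hp : e ⟨p, by omega⟩ < p := by
      have := hr ⟨0, hn⟩
      rw [show (⟨p, by omega⟩ : Fin (p + n)) = Fin.natAdd p ⟨0, hn⟩ from rfl, this]
      simpa using hf ⟨0, hn⟩
    refine ⟨e, ⟨mem_avoiding.2 ⟨hmem, ?_⟩, (iar_eq_iff hmem p).2 ⟨by omega, hid, fun _ => hp⟩⟩,
      funext hr⟩
    rw [Avoids, contains_0021_iff]
    rintro ⟨h, i, j, k, hhi, hij, hjk, heq, hik, hkj⟩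
    rw [Fin.lt_def] at hhi hij hjk
    have hpi : p ≤ i := by
      by_contra hc
      rw [hid h (by omega), hid i (by omega)] at heq
      omega
    have hex : ∀ x : Fin (p + n), p ≤ x → ∃ y : Fin n, x = Fin.natAdd p y := fun x hx =>
      ⟨⟨x - p, by omega⟩, by ext; simp; omega⟩
    obtain ⟨i, rfl⟩ := hex i hpi
    obtain ⟨j, rfl⟩ := hex j (by omega)
    obtain ⟨k, rfl⟩ := hex k (by omega)
    simp only [hr, Fin.val_natAdd, Nat.add_lt_add_iff_left] at *
    exact hav (contains_021_iff.2 ⟨i, j, k, hij, hjk, hik, hkj⟩)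

variable {R : Type*} [CommRing R]

open Classical in
theorem sum_iar_eq_length (t : R) (N : ℕ) :
    ∑ e ∈ avoiding (invSeqs (N + 1)) ![0, 0, 2, 1] with iar e = N + 1, t ^ asc e = t ^ N := by
  have h : (avoiding (invSeqs (N + 1)) ![0, 0, 2, 1]).filter (fun e => iar e = N + 1) =
      {fun i : Fin (N + 1) => (i : ℕ)} := by
    ext e
    rw [mem_filter, mem_avoiding, mem_singleton]
    constructor
    · rintro ⟨⟨he, -⟩, h⟩
      ext i
      exact ((iar_eq_iff he _).1 h).2.1 i i.isLt
    · rintro rfl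
      have hmem : (fun i : Fin (N + 1) => (i : ℕ)) ∈ invSeqs (N + 1) :=
        mem_invSeqs.2 fun i => Nat.lt_succ_self _
      refine ⟨⟨hmem, ?_⟩, (iar_eq_iff hmem _).2
        ⟨le_rfl, fun _ _ => rfl, fun h => absurd h (lt_irrefl _)⟩⟩
      rw [Avoids, contains_0021_iff]
      rintro ⟨h, i, j, k, hhi, -, -, heq, -⟩
      exact hhi.ne (Fin.ext heq)
  rw [h, sum_singleton, asc_id]

open Classical in
theorem sum_iar_eq (t : R) {L p n : ℕ} (hL : L = p + 1 + (n + 1)) :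
    ∑ e ∈ avoiding (invSeqs L) ![0, 0, 2, 1] with iar e = p + 1, t ^ asc e =
      t ^ p * ∑ a ∈ range (p + 1), contSum t a n (p - a + 2) a := by
  subst hL
  have hbij := bijOn_drop_initial_run (n := n + 1) (p := p + 1) (by omega)
  simp only [contSum]
  rw [← sum_avoiding_invSeqsFrom n p fun w => t ^ asc w, mul_sum]
  refine sum_nbij (fun e i => e (Fin.natAdd (p + 1) i)) ?_ ?_ ?_ ?_
  · exact fun e he => hbij.mapsTo (mem_filter.1 he)
  · exact fun e he e' he' => hbij.injOn (mem_filter.1 he) (mem_filter.1 he')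
  · intro f hf
    obtain ⟨e, he, h⟩ := hbij.surjOn hf
    exact ⟨e, mem_filter.2 he, h⟩
  · intro e he
    obtain ⟨he, h⟩ := mem_filter.1 he
    obtain ⟨-, h1, h2⟩ := (iar_eq_iff (mem_avoiding.1 he).1 _).1 h
    rw [asc_of_initial_run h1 h2, pow_add]

theorem coeff_genFun_succ (t : R) (N : ℕ) : PowerSeries.coeff (N + 1) (genFun t) =
    t ^ N + ∑ p ∈ range N, t ^ p * ∑ a ∈ range (p + 1), contSum t a (N - 1 - p) (p - a + 2) a := by
  classical
  rw [genFun, PowerSeries.coeff_mk, if_neg (Nat.succ_ne_zero N)]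
  rw [← sum_fiberwise_of_maps_to (s := avoiding (invSeqs (N + 1)) ![0, 0, 2, 1])
    (t := (range (N + 1)).image (· + 1)) (g := iar) ?_, sum_image (by simp), sum_range_succ,
    sum_iar_eq_length, add_comm]
  · congr 1
    refine sum_congr rfl fun p hp => sum_iar_eq t ?_
    have := mem_range.1 hp
    omega
  · intro e he
    have he := (mem_avoiding.1 he).1
    obtain ⟨h1, -, h2⟩ := (iar_eq_iff he (iar e)).1 rfl
    have h3 : iar e ≠ 0 := fun h => by
      have := h2 (by omega)
      omega
    exact mem_image.2 ⟨iar e - 1, mem_range.2 (by omega), by omega⟩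

theorem coeff_genFun_add_two (t : R) (N : ℕ) : PowerSeries.coeff (N + 2) (genFun t) =
    t ^ (N + 1) + ∑ x ∈ antidiagonal N,
      t ^ x.2 * ∑ a ∈ range (x.2 + 1), contSum t a x.1 (x.2 - a + 2) a := by
  rw [coeff_genFun_succ, ← Nat.sum_antidiagonal_swap, Nat.sum_antidiagonal_eq_sum_range_succ_mk]
  rfl

end InitialRun

end InvSeq

theorem mainTheorem5 {R : Type*} [CommRing R] (t : R) :
    (∃ r : PowerSeries R,
        InvSeq.IsKernelRoot t r ∧
        (∀ r' : PowerSeries R, InvSeq.IsKernelRoot t r' → r' = r) ∧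
        PowerSeries.coeff 1 r = 1 ∧
        PowerSeries.coeff 2 r = t ∧
        PowerSeries.coeff 3 r = t ^ 2 + 2 * t ∧
        PowerSeries.coeff 4 r = t ^ 3 + 8 * t ^ 2 + 3 * t ∧
        PowerSeries.coeff 5 r = t ^ 4 + 22 * t ^ 3 + 27 * t ^ 2 + 4 * t ∧
        IsUnit (1 - r) ∧
        InvSeq.genFun t = r * Ring.inverse (1 - r)) ∧
    (∀ n p : ℕ, 1 ≤ n → 1 ≤ p →
      Set.BijOn (fun (e : Fin (p + n) → ℕ) (i : Fin n) => e (Fin.natAdd p i))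
        {e | e ∈ InvSeq.avoiding (InvSeq.invSeqs (p + n)) ![0, 0, 2, 1] ∧ InvSeq.iar e = p}
        {e | e ∈ InvSeq.avoiding (InvSeq.invSeqsFrom n p) ![0, 2, 1]}) := by
  refine ⟨?_, fun n p hn _ => InvSeq.bijOn_drop_initial_run hn⟩
  obtain ⟨V, hV⟩ := InvSeq.exists_auxSeries t
  specialize hV _ _ rfl rfl
  have hroot := InvSeq.isKernelRoot_of_auxSeries rfl rfl hV
  obtain ⟨h1, h2, h3, h4, h5⟩ := hroot.coeffs
  refine ⟨_, hroot, fun r' hr' => hr'.unique hroot, h1, h2, h3, h4, h5, ?_, ?_⟩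
  · rw [PowerSeries.isUnit_iff_constantCoeff]
    simp
  · refine InvSeq.eq_mul_inverse_of_coeff (G := fun n q a => InvSeq.contSum t a n q a)
      (H := fun n q a => InvSeq.contSum t (a + 1) n q a)
      (fun q a => InvSeq.contSum_zero t a q a) (fun q a => InvSeq.contSum_zero t (a + 1) q a)
      (InvSeq.contSum_succ t) (InvSeq.contSum_add_one_succ t) rfl rfl hV ?_ ?_
      (InvSeq.coeff_genFun_add_two t)
    · simp [InvSeq.genFun]
    · rw [InvSeq.coeff_genFun_succ]
      simp
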